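/- Let $X$ be a Tychonoff space. A zero set of $X$ is a set $\{x : f(x)=0\}$ with $f\in C(X)$. A $z$-filter on $X$ is a nonempty family of zero sets of $X$ that does not contain $\emptyset$, is closed under finite intersections, and contains every zero set that includes one of its members; a $z$-ultrafilter is a maximal $z$-filter, and it is fixed if the intersection of its members is nonempty. A space $Y$ is pseudocompact if every continuous real-valued function on $Y$ is bounded. A space $Y$ is realcompact if every family $\mathcal S$ of closed subsets of $Y$ that has the finite intersection property and is stable (every $f\in C(Y)$ is bounded on some member of $\mathcal S$) has nonempty intersection. A subset $H$ of $X$ is hard if it is closed and there is a compact $K\subseteq X$ such that for every open $V\supseteq K$ there is a realcompact $P\subseteq X$ with $H\setminus V$ completely separated from $X\setminus P$. An $hz$-filter is a $z$-filter having a base of hard zero sets, and an $hz$-ultrafilter is a maximal $hz$-filter. Let $\delta X$ be the set of all fixed $z$-ultrafilters on $X$ together with all $hz$-ultrafilters on $X$, with the topology for which the sets $\overline Z=\{p\in\delta X : Z\in p\}$, $Z$ a zero set of $X$, form a base for the closed sets. Then $\delta X$ is a nearly pseudocompact (Tychonoff) space. That is, $\delta X$ is Tychonoff, and there are subsets $\delta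 X_1,\delta X_2$ with $\delta X=\delta X_1\cup\delta X_2$ such that: - $\delta X_1$ is regular closed (the closure of its interior), almost locally compact (equal to the closure in $\delta X$ of the set of all points of $\delta X$ having a compact neighbourhood), and pseudocompact as a subspace; - $\delta X_2$ is regular closed and, as a subspace, anti-locally realcompact (no point of it has a realcompact neighbourhood); - $\delta X_1\cap\delta X_2$ has empty interior in $\delta X$. -/

import Mathlib

open Set Topology

namespace NearlyPseudo

universe u

section Basic

variable (X : Type u) [TopologicalSpace X]

/-- `X` is pseudocompact: every continuous real-valued function on `X` is bounded. -/
def IsPseudocompactSpace : Prop :=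
  ∀ f : C(X, ℝ), ∃ M : ℝ, ∀ x, |f x| ≤ M

variable {X}

/-- A family of subsets of `X` is stable if every continuous real-valued function on `X` is
bounded on some member of the family. -/
def IsStableFamily (S : Set (Set X)) : Prop :=
  ∀ f : C(X, ℝ), ∃ D ∈ S, ∃ M : ℝ, ∀ x ∈ D, |f x| ≤ M

/-- The finite intersection property. -/
def HasFIP (S : Set (Set X)) : Prop :=
  ∀ T : Set (Set X), T ⊆ S → T.Finite → (⋂₀ T).Nonempty

variable (X) in
/-- `X` is realcompact: every stable family of closed sets with the finite intersection property
is fixed, that is, has nonempty intersection. -/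
def IsRealcompactSpace : Prop :=
  ∀ S : Set (Set X), (∀ F ∈ S, IsClosed F) → IsStableFamily S → HasFIP S → (⋂₀ S).Nonempty

variable (X) in
/-- `X` is anti-locally realcompact: no point of `X` has a realcompact neighbourhood. -/
def IsAntiLocallyRealcompact : Prop :=
  ∀ x : X, ¬ ∃ N ∈ 𝓝 x, IsRealcompactSpace N

/-- A regular closed subset: the closure of its interior. -/
def IsRegularClosed (A : Set X) : Prop :=
  closure (interior A) = A

/-- A subset of `X` is almost locally compact if it is the closure in `X` of the set of all points
of `X` that have a compact neighbourhood in `X`. -/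
def IsAlmostLocallyCompact (A : Set X) : Prop :=
  A = closure {x : X | ∃ K ∈ 𝓝 x, IsCompact K}

variable (X) in
/-- `X` is nearly pseudocompact: `X` is the union of a regular closed, almost locally compact,
pseudocompact subset and a regular closed, anti-locally realcompact subset whose intersection has
empty interior. -/
def IsNearlyPseudocompact : Prop :=
  ∃ X₁ X₂ : Set X, X₁ ∪ X₂ = univ ∧
    (IsRegularClosed X₁ ∧ IsAlmostLocallyCompact X₁ ∧ IsPseudocompactSpace X₁) ∧
    (IsRegularClosed X₂ ∧ IsAntiLocallyRealcompact X₂) ∧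
    interior (X₁ ∩ X₂) = ∅

/-- `Z` is a zero set: the set of zeros of some continuous real-valued function. -/
def IsZeroSet (Z : Set X) : Prop :=
  ∃ f : C(X, ℝ), Z = {x | f x = 0}

/-- `A` and `B` are completely separated in `X`. -/
def CompletelySeparated (A B : Set X) : Prop :=
  ∃ f : C(X, ℝ), (∀ x, f x ∈ Icc (0 : ℝ) 1) ∧ (∀ x ∈ A, f x = 0) ∧ (∀ x ∈ B, f x = 1)

/-- `H` is hard in `X`. -/
def IsHard (H : Set X) : Prop :=
  IsClosed H ∧ ∃ K : Set X, IsCompact K ∧ ∀ V : Set X, IsOpen V → K ⊆ V →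
    ∃ P : Set X, IsRealcompactSpace P ∧ CompletelySeparated (H \ V) Pᶜ

/-- `F` is a z-filter on `X`. -/
structure IsZFilter (F : Set (Set X)) : Prop where
  isZeroSet : ∀ Z ∈ F, IsZeroSet Z
  nonempty : F.Nonempty
  empty_notMem : ∅ ∉ F
  inter_mem : ∀ Z ∈ F, ∀ W ∈ F, Z ∩ W ∈ F
  superset_mem : ∀ Z ∈ F, ∀ W, IsZeroSet W → Z ⊆ W → W ∈ F

/-- A z-ultrafilter is a maximal z-filter. -/
def IsZUltrafilter (F : Set (Set X)) : Prop :=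
  Maximal IsZFilter F

/-- An hz-filter is a z-filter that has a base consisting of hard zero sets. -/
def IsHZFilter (F : Set (Set X)) : Prop :=
  IsZFilter F ∧ ∀ Z ∈ F, ∃ H ∈ F, IsZeroSet H ∧ IsHard H ∧ H ⊆ Z

/-- An hz-ultrafilter is a maximal hz-filter. -/
def IsHZUltrafilter (F : Set (Set X)) : Prop :=
  Maximal IsHZFilter F

end Basic

/-- The points of `δX`: all fixed z-ultrafilters together with all hz-ultrafilters on `X`. -/
def Delta (X : Type u) [TopologicalSpace X] : Type u :=
  {p : Set (Set X) // (IsZUltrafilter p ∧ (⋂₀ p).Nonempty) ∨ IsHZUltrafilter p}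

namespace Delta

variable {X : Type u} [TopologicalSpace X]

/-- The set `Z̄` of all points `p` of `δX` with `Z ∈ p`. -/
def bar (Z : Set X) : Set (Delta X) :=
  {p | Z ∈ p.1}

/-- The topology of `δX`, with the sets `Z̄`, for `Z` a zero set of `X`, as a base for the closed
sets; see `isTopologicalBasis_compl_bar`. -/
instance : TopologicalSpace (Delta X) :=
  TopologicalSpace.generateFrom {U | ∃ Z : Set X, IsZeroSet Z ∧ U = (bar Z)ᶜ}

end Delta

section Helper

variable {X : Type u} [TopologicalSpace X]

theorem isZeroSet_inter {Z W : Set X} (hZ : IsZeroSet Z) (hW : IsZeroSet W) :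
    IsZeroSet (Z ∩ W) := by
  obtain ⟨f, rfl⟩ := hZ
  obtain ⟨g, rfl⟩ := hW
  refine ⟨f * f + g * g, ?_⟩
  ext x
  constructor
  · rintro ⟨h1, h2⟩
    simp_all
  · intro h
    have h' : f x * f x + g x * g x = 0 := h
    constructor
    · show f x = 0
      nlinarith [mul_self_nonneg (f x), mul_self_nonneg (g x)]
    · show g x = 0
      nlinarith [mul_self_nonneg (f x), mul_self_nonneg (g x)]

theorem isZeroSet_union {Z W : Set X} (hZ : IsZeroSet Z) (hW : IsZeroSet W) :
    IsZeroSet (Z ∪ W) := by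
  obtain ⟨f, rfl⟩ := hZ
  obtain ⟨g, rfl⟩ := hW
  exact ⟨f * g, by ext x; simp⟩

theorem isZeroSet_empty : IsZeroSet (∅ : Set X) :=
  ⟨1, by ext x; simp⟩

theorem IsZUltrafilter.mem_of_forall_inter {p : Set (Set X)} (hp : IsZUltrafilter p) {Z : Set X}
    (hZ : IsZeroSet Z) (h : ∀ W ∈ p, (Z ∩ W).Nonempty) : Z ∈ p := by
  have hf := hp.1
  let q : Set (Set X) := {A | IsZeroSet A ∧ ∃ W ∈ p, Z ∩ W ⊆ A}
  have hq : IsZFilter q :=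
    { isZeroSet := fun A hA => hA.1
      nonempty := by
        obtain ⟨W, hW⟩ := hf.nonempty
        exact ⟨W, hf.isZeroSet W hW, W, hW, inter_subset_right⟩
      empty_notMem := by
        rintro ⟨-, W, hW, hs⟩
        obtain ⟨x, hx⟩ := h W hW
        exact hs hx
      inter_mem := by
        rintro A ⟨hA, W, hW, hs⟩ B ⟨hB, W', hW', hs'⟩
        exact ⟨isZeroSet_inter hA hB, W ∩ W', hf.inter_mem W hW W' hW',
          fun x hx => ⟨hs ⟨hx.1, hx.2.1⟩, hs' ⟨hx.1, hx.2.2⟩⟩⟩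
      superset_mem := by
        rintro A ⟨-, W, hW, hs⟩ B hB hAB
        exact ⟨hB, W, hW, hs.trans hAB⟩ }
  have hpq : p ⊆ q := fun A hA => ⟨hf.isZeroSet A hA, A, hA, inter_subset_right⟩
  obtain ⟨W, hW⟩ := hf.nonempty
  exact hp.2 hq hpq ⟨hZ, W, hW, inter_subset_left⟩

theorem IsZUltrafilter.mem_or_mem {p : Set (Set X)} (hp : IsZUltrafilter p) {Z W : Set X}
    (hZ : IsZeroSet Z) (hW : IsZeroSet W) (h : Z ∪ W ∈ p) : Z ∈ p ∨ W ∈ p := by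
  by_contra! hc
  have h1 : ∃ A ∈ p, Z ∩ A = ∅ := by
    by_contra! h'
    exact hc.1 (hp.mem_of_forall_inter hZ h')
  have h2 : ∃ B ∈ p, W ∩ B = ∅ := by
    by_contra! h'
    exact hc.2 (hp.mem_of_forall_inter hW h')
  obtain ⟨A, hA, hZA⟩ := h1
  obtain ⟨B, hB, hWB⟩ := h2
  have hm := hp.1.inter_mem _ h _ (hp.1.inter_mem A hA B hB)
  have he : (Z ∪ W) ∩ (A ∩ B) = ∅ := by
    rw [eq_empty_iff_forall_notMem] at hZA hWB ⊢
    rintro x ⟨hx | hx, hxA, hxB⟩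
    · exact hZA x ⟨hx, hxA⟩
    · exact hWB x ⟨hx, hxB⟩
  exact hp.1.empty_notMem (he ▸ hm)

theorem isHard_of_subset {H L : Set X} (hH : IsHard H) (hL : IsClosed L) (h : L ⊆ H) :
    IsHard L := by
  obtain ⟨-, K, hK, hs⟩ := hH
  refine ⟨hL, K, hK, fun V hV hKV => ?_⟩
  obtain ⟨P, hP, f, hf, h0, h1⟩ := hs V hV hKV
  exact ⟨P, hP, f, hf, fun x hx => h0 x ⟨h hx.1, hx.2⟩, h1⟩

theorem IsZeroSet.isClosed {Z : Set X} (hZ : IsZeroSet Z) : IsClosed Z := by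
  obtain ⟨f, rfl⟩ := hZ
  exact isClosed_eq f.continuous continuous_const

theorem IsHZUltrafilter.isZUltrafilter {p : Set (Set X)} (hp : IsHZUltrafilter p) :
    IsZUltrafilter p := by
  refine ⟨hp.1.1, fun q hq hpq => hp.2 ⟨hq, fun Z hZ => ?_⟩ hpq⟩
  obtain ⟨W, hW⟩ := hp.1.1.nonempty
  obtain ⟨H, hH, hH0, hHh, -⟩ := hp.1.2 W hW
  have hm := hq.inter_mem Z hZ H (hpq hH)
  have h0 := hq.isZeroSet _ hm
  exact ⟨Z ∩ H, hm, h0, isHard_of_subset hHh h0.isClosed inter_subset_right, inter_subset_left⟩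

theorem Delta.isZUltrafilter (p : Delta X) : IsZUltrafilter p.1 :=
  p.2.elim And.left IsHZUltrafilter.isZUltrafilter

/-- The sets `Z̄` form a base for the closed sets of `δX`. -/
theorem Delta.isTopologicalBasis_compl_bar :
    TopologicalSpace.IsTopologicalBasis
      {U : Set (Delta X) | ∃ Z : Set X, IsZeroSet Z ∧ U = (Delta.bar Z)ᶜ} := by
  refine TopologicalSpace.isTopologicalBasis_of_subbasis_of_finiteInter rfl ⟨?_, ?_⟩
  · refine ⟨∅, isZeroSet_empty, ?_⟩
    ext p
    have := p.isZUltrafilter.1.empty_notMem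
    simpa [Delta.bar] using this
  · rintro _ ⟨Z, hZ, rfl⟩ _ ⟨W, hW, rfl⟩
    refine ⟨Z ∪ W, isZeroSet_union hZ hW, ?_⟩
    ext p
    have hp := p.isZUltrafilter
    have hu := isZeroSet_union hZ hW
    constructor
    · rintro ⟨h1, h2⟩ h
      exact (hp.mem_or_mem hZ hW h).elim h1 h2
    · intro h
      exact ⟨fun h1 => h (hp.1.superset_mem Z h1 _ hu subset_union_left),
        fun h2 => h (hp.1.superset_mem W h2 _ hu subset_union_right)⟩

end Helper

end NearlyPseudo

/-! The space `δX` lies between `X` and `βX`: every z-ultrafilter is the trace on `X` of a unique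
point of `βX`, and the topology of `δX` is the subspace topology (`Delta.isEmbedding_toStoneCech`),
so `δX` is Tychonoff.

Let `N` be the remainder `υX \ X`, the points outside `X` near which every continuous function on
`X` is bounded. A z-ultrafilter with a hard member never sits at a point of `N`
(`mem_range_of_isHard_mem_zeroSetTrace`), while every point off the closure of `N` is an
hz-ultrafilter (`isHZUltrafilter_zeroSetTrace`). Hence `N` misses `δX` and is dense in `βX \ δX`.
Restriction to `X` shows that functions on `δX` are also bounded near points of `N`.

It remains to apply a criterion for a dense C*-embedded subspace `Y` of a compact space whose real
remainder is dense in its remainder (`isNearlyPseudocompact_of_dense_realRemainder`). The first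
piece is the closure of the set of points of local compactness, the second the closure of its
complement. An unbounded function on the first, or a realcompact neighbourhood in the second, would
force a point of the real remainder into `Y`. -/

namespace NearlyPseudo

open Filter

/-! ### Dense subspaces of compact spaces and their real remainders -/

section DenseEmbedding

variable {Y B Q : Type*} [TopologicalSpace Y] [TopologicalSpace B] [TopologicalSpace Q]

/-- Every continuous real-valued function on `Y` is bounded near the point `b` of the
extension `B` of `Y`. -/
def BoundedAt (e : Y → B) (b : B) : Prop :=
  ∀ f : C(Y, ℝ), ∃ U ∈ 𝓝 b, ∃ M : ℝ, ∀ y, e y ∈ U → |f y| ≤ M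

/-- The points of the remainder of `Y` in `B` near which all continuous real-valued functions
on `Y` are bounded. For `B = βY` this is `υY \ Y`. -/
def realRemainder (e : Y → B) : Set B :=
  {b | b ∉ range e ∧ BoundedAt e b}

variable [CompactSpace B] [T2Space B] {e : Y → B}

theorem exists_continuous_zero_at_one_on {C : Set B} (hC : IsClosed C) {b : B} (hb : b ∉ C) :
    ∃ φ : C(B, ℝ), φ b = 0 ∧ (∀ c ∈ C, φ c = 1) ∧ ∀ x, φ x ∈ Icc (0 : ℝ) 1 := by
  obtain ⟨φ, h0, h1, h2⟩ := exists_continuous_zero_one_of_isClosed (isClosed_singleton (x := b)) hC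
    (by simpa using hb)
  exact ⟨φ, h0 rfl, fun c hc => h1 hc, h2⟩

theorem exists_continuous_lt_one_subset {O : Set B} {b : B} (hO : O ∈ 𝓝 b) :
    ∃ φ : C(B, ℝ), φ b = 0 ∧ (∀ x, φ x < 1 → x ∈ O) ∧ ∀ x, φ x ∈ Icc (0 : ℝ) 1 := by
  obtain ⟨φ, h0, h1, h2⟩ := exists_continuous_zero_at_one_on
    (isClosed_compl_iff.2 (isOpen_interior (s := O))) (b := b)
    (by simpa [mem_interior_iff_mem_nhds] using hO)
  refine ⟨φ, h0, fun x hx => ?_, h2⟩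
  by_contra hxO
  exact hx.ne (h1 x fun h => hxO (interior_subset h))

/-- A realcompact subspace of `Y` which contains the trace of a neighbourhood of `b` excludes `b`
from the remainder if continuous functions are bounded near `b`. -/
theorem mem_range_of_isRealcompactSpace (he : Continuous e) (hd : DenseRange e) {j : Q → Y}
    (hj : IsEmbedding j) (hQ : IsRealcompactSpace Q) {b : B} (hb : BoundedAt e b) {O : Set B}
    (hO : O ∈ 𝓝 b) (hOj : e ⁻¹' O ⊆ range j) : b ∈ range e := by
  have hne : (comap (e ∘ j) (𝓝 b)).NeBot := by
    refine comap_neBot fun t ht => ?_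
    obtain ⟨y, hy⟩ := hd.exists_mem_open (isOpen_interior (s := t ∩ O))
      ⟨b, mem_interior_iff_mem_nhds.2 (inter_mem ht hO)⟩
    have hy' := interior_subset hy
    obtain ⟨q, rfl⟩ := hOj hy'.2
    exact ⟨q, hy'.1⟩
  have hstable : IsStableFamily {A : Set Q | ∃ G ∈ 𝓝 b, A = (e ∘ j) ⁻¹' closure G} := by
    intro f
    obtain ⟨φ, hφb, hφO, hφ⟩ := exists_continuous_lt_one_subset hO
    let F : Y → ℝ := Function.extend j f 0
    have hF : ∀ q, F (j q) = f q := fun q => hj.injective.extend_apply f 0 q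
    -- The cutoff vanishes where `φ ≥ 1/2`, and `F` is continuous where `φ < 1`, so the junk values
    -- of `F` off `range j` do no harm. Where `φ < 1/4` the cutoff is at least `1/4`, whence the
    -- bound `4 * M` below.
    have hg : Continuous fun y => F y * max 0 (1 / 2 - φ (e y)) := by
      rw [continuous_iff_continuousAt]
      intro y
      by_cases hy : φ (e y) < 1
      · have hev : range j ∈ 𝓝 y := by
          have h1 : ∀ᶠ z in 𝓝 y, φ (e z) < 1 :=
            ((φ.continuous.comp he).continuousAt (x := y)).eventually_lt continuousAt_const hy
          filter_upwards [h1] with z hz using hOj (hφO _ hz)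
        obtain ⟨q, rfl⟩ := mem_of_mem_nhds hev
        have hFc : ContinuousAt F (j q) := by
          rw [ContinuousAt, ← hj.isInducing.map_nhds_of_mem q hev, tendsto_map'_iff, hF]
          have : F ∘ j = f := funext hF
          rw [this]
          exact f.continuous.continuousAt
        exact hFc.mul (by fun_prop)
      · have hev : ∀ᶠ z in 𝓝 y, 1 / 2 < φ (e z) :=
          continuousAt_const.eventually_lt ((φ.continuous.comp he).continuousAt (x := y))
            (by change 1 / 2 < φ (e y); linarith)
        refine (continuousAt_const (y := (0 : ℝ))).congr ?_
        filter_upwards [hev] with z hz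
        rw [max_eq_left (by linarith), mul_zero]
    obtain ⟨U, hU, M, hM⟩ := hb ⟨_, hg⟩
    have hG : U ∩ {x | φ x < 1 / 4} ∈ 𝓝 b :=
      inter_mem hU (φ.continuous.continuousAt.eventually_lt continuousAt_const (by rw [hφb]; norm_num))
    obtain ⟨G, hG, hGc, hGs⟩ := exists_mem_nhds_isClosed_subset hG
    refine ⟨_, ⟨G, hG, rfl⟩, 4 * M, fun q hq => ?_⟩
    rw [mem_preimage, hGc.closure_eq] at hq
    have h1 := hM (j q) (hGs hq).1
    have h2 : φ (e (j q)) < 1 / 4 := (hGs hq).2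
    have h3 : 1 / 4 ≤ max 0 (1 / 2 - φ (e (j q))) := le_max_of_le_right (by linarith)
    simp only [ContinuousMap.coe_mk, hF, abs_mul] at h1
    have h4 := le_abs_self (max 0 (1 / 2 - φ (e (j q))))
    nlinarith [mul_le_mul_of_nonneg_left (h3.trans h4) (abs_nonneg (f q))]
  obtain ⟨q, hq⟩ := hQ _ (by
    rintro _ ⟨G, -, rfl⟩
    exact isClosed_closure.preimage (he.comp hj.continuous)) hstable (by
    intro T hT hfin
    refine nonempty_of_mem (f := comap (e ∘ j) (𝓝 b)) ((sInter_mem hfin).2 fun A hA => ?_)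
    obtain ⟨G, hG, rfl⟩ := hT hA
    exact ⟨G, hG, preimage_mono subset_closure⟩)
  refine ⟨j q, ?_⟩
  by_contra hne
  obtain ⟨U, V, hU, hV, hqU, hbV, hUV⟩ := t2_separation hne
  have h1 : e (j q) ∈ closure V := hq _ ⟨V, hV.mem_nhds hbV, rfl⟩
  exact (hUV.symm.closure_left hU).le_bot ⟨h1, hqU⟩

/-- The points of `Y` with a compact neighbourhood are those in the interior of `Y` in `B`. -/
theorem exists_isCompact_mem_nhds_iff (he : IsEmbedding e) (hd : DenseRange e) {y : Y} :
    (∃ K ∈ 𝓝 y, IsCompact K) ↔ e y ∈ interior (range e) := by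
  constructor
  · rintro ⟨K, hK, hKc⟩
    rw [he.nhds_eq_comap] at hK
    obtain ⟨U, hU, hUK⟩ := hK
    obtain ⟨O, hOU, hO, hyO⟩ := mem_nhds_iff.1 hU
    refine mem_interior.2 ⟨O, ?_, hO, hyO⟩
    have h1 : O ∩ range e ⊆ e '' K := by
      rintro _ ⟨hz, z, rfl⟩
      exact ⟨z, hUK (hOU hz), rfl⟩
    calc O ⊆ closure (O ∩ range e) := hd.open_subset_closure_inter hO
      _ ⊆ e '' K := closure_minimal h1 (hKc.image he.continuous).isClosed
      _ ⊆ range e := image_subset_range _ _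
  · intro hy
    obtain ⟨L, hL, hLc, hLs⟩ := exists_mem_nhds_isClosed_subset (mem_interior_iff_mem_nhds.1 hy)
    exact ⟨e ⁻¹' L, he.continuous.continuousAt.preimage_mem_nhds hL,
      he.isInducing.isCompact_preimage' hLc.isCompact hLs⟩

/-- Bump functions with compact support at points of local compactness. -/
theorem exists_bump (he : IsEmbedding e) {y : Y} (hy : e y ∈ interior (range e)) {U : Set Y}
    (hU : U ∈ 𝓝 y) : ∃ (g : C(Y, ℝ)) (C : Set Y), IsCompact C ∧ IsClosed C ∧ C ⊆ U ∧
      (∀ z, 0 ≤ g z) ∧ g y = 1 ∧ y ∈ C ∧ ∀ z, g z ≠ 0 → z ∈ C := by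
  rw [he.nhds_eq_comap] at hU
  obtain ⟨O, hO, hOU⟩ := hU
  obtain ⟨φ, h0, h1, h2⟩ :=
    exists_continuous_lt_one_subset (inter_mem hO (mem_interior_iff_mem_nhds.1 hy))
  have hcl : IsClosed {x | φ x ≤ 1 / 2} := isClosed_le φ.continuous continuous_const
  have hlt : ∀ x, φ x ≤ 1 / 2 → φ x < 1 := fun x hx => hx.trans_lt (by norm_num)
  have hc := he.continuous
  refine ⟨⟨fun z => max 0 (1 - 2 * φ (e z)), by fun_prop⟩, e ⁻¹' {x | φ x ≤ 1 / 2},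
    he.isInducing.isCompact_preimage' hcl.isCompact fun x hx => (h1 x (hlt x hx)).2,
    hcl.preimage hc, fun z hz => hOU (h1 _ (hlt _ hz)).1, fun z => le_max_left _ _, ?_, ?_, ?_⟩
  · simp [h0]
  · simp [h0]
  · intro z hz
    by_contra hzC
    simp only [mem_preimage, mem_ofPred_eq, not_le] at hzC
    exact hz (max_eq_left (by linarith))

/-- An unbounded function yields a locally finite sequence of compact sets `C n` in `U`, on which
`|f|` exceeds `n`. A sum of bumps on them extends to `B` and is large near a remainder point `q`,
hence at some real remainder point `ν`. Boundedness near `ν` leaves only finitely many `C n` there,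
and their compact union captures `ν`. -/
theorem isPseudocompactSpace_closure (he : IsEmbedding e) (hd : DenseRange e)
    (hN : (range e)ᶜ ⊆ closure (realRemainder e))
    (hext : ∀ h : C(Y, ℝ), (∀ y, h y ∈ Icc (0 : ℝ) 1) → ∃ h' : C(B, ℝ), ∀ y, h' (e y) = h y) :
    IsPseudocompactSpace (closure (e ⁻¹' interior (range e))) := by
  set U : Set Y := e ⁻¹' interior (range e)
  have hU : IsOpen U := isOpen_interior.preimage he.continuous
  intro f
  by_contra! hf
  let F : Y → ℝ := Function.extend ((↑) : closure U → Y) (fun y => |f y|) 0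
  have hFf : ∀ y : closure U, F y = |f y| :=
    fun y => Subtype.val_injective.extend_apply (fun y => |f y|) 0 y
  have hF : ContinuousOn F (closure U) := by
    rw [continuousOn_iff_continuous_domRestrict]
    have : (closure U).domRestrict F = fun y => |f y| := funext hFf
    rw [this]
    fun_prop
  have hunb : ∀ n : ℕ, ∃ x ∈ U, (n : ℝ) < F x := by
    intro n
    by_contra! h
    obtain ⟨y, hy⟩ := hf n
    have := le_on_closure h hF continuousOn_const y.2
    rw [hFf] at this
    linarith
  choose x hxU hxF using hunb
  have hFU : ∀ y ∈ U, ContinuousAt F y := fun y hy =>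
    hF.continuousAt (mem_of_superset (hU.mem_nhds hy) subset_closure)
  have hbump : ∀ n : ℕ, ∃ (g : C(Y, ℝ)) (C : Set Y), IsCompact C ∧ IsClosed C ∧
      C ⊆ U ∩ {y | (n : ℝ) < F y} ∧ (∀ z, 0 ≤ g z) ∧ g (x n) = 1 ∧ x n ∈ C ∧
      ∀ z, g z ≠ 0 → z ∈ C := fun n =>
    exists_bump he (hxU n) (inter_mem (hU.mem_nhds (hxU n))
      (continuousAt_const.eventually_lt (hFU _ (hxU n)) (hxF n)))
  choose g C hCc hCcl hCU hg0 hg1 hxC hgC using hbump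
  -- On `closure U` the function `F` is locally bounded and exceeds `n` on `C n`; off `closure U`
  -- there are no `C n`.
  have hlf : LocallyFinite C := by
    intro y
    by_cases hy : y ∈ closure U
    · have h1 : ∀ᶠ z in 𝓝[closure U] y, F z < F y + 1 :=
        (hF y hy).eventually_lt continuousWithinAt_const (by simp)
      refine ⟨_, eventually_nhdsWithin_iff.1 h1, ?_⟩
      refine (finite_le_nat ⌈F y + 1⌉₊).subset ?_
      rintro n ⟨z, hzC, hz⟩
      have h2 := hz (subset_closure (hCU n hzC).1)
      have h3 : (n : ℝ) < F z := (hCU n hzC).2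
      have h4 := Nat.le_ceil (F y + 1)
      have : (n : ℝ) ≤ ⌈F y + 1⌉₊ := by linarith
      exact_mod_cast this
    · refine ⟨(closure U)ᶜ, isClosed_closure.isOpen_compl.mem_nhds hy, ?_⟩
      refine finite_empty.subset ?_
      rintro n ⟨z, hzC, hz⟩
      exact hz (subset_closure (hCU n hzC).1)
  have hlfg : LocallyFinite fun n => Function.support (g n) := hlf.subset fun n z hz => hgC n z hz
  let h : C(Y, ℝ) := ⟨fun y => min 1 (∑ᶠ n, g n y),
    continuous_const.min (continuous_finsum (fun n => (g n).continuous) hlfg)⟩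
  have hhdef : ∀ y, h y = min 1 (∑ᶠ n, g n y) := fun y => rfl
  have hsum0 : ∀ y, 0 ≤ ∑ᶠ n, g n y := fun y => finsum_nonneg fun n => hg0 n y
  have hh : ∀ y, h y ∈ Icc (0 : ℝ) 1 := fun y =>
    ⟨le_min zero_le_one (hsum0 y), min_le_left _ _⟩
  have hhC : ∀ y, h y ≠ 0 → ∃ n, y ∈ C n := by
    intro y hy
    by_contra! hc
    apply hy
    have : ∀ n, g n y = 0 := fun n => by
      by_contra hn
      exact hc n (hgC n y hn)
    simp [hhdef, this]
  have hhx : ∀ n, h (x n) = 1 := by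
    intro n
    refine min_eq_left ?_
    rw [← hg1 n]
    exact single_le_finsum n (hlfg.point_finite (x n)) fun m => hg0 m (x n)
  obtain ⟨h', hh'⟩ := hext h hh
  let k : C(Y, ℝ) := ⟨fun y => F y * h y, by
    rw [continuous_iff_continuousAt]
    intro y
    by_cases hy : y ∈ ⋃ n, C n
    · obtain ⟨n, hn⟩ := mem_iUnion.1 hy
      exact (hFU y (hCU n hn).1).mul h.continuous.continuousAt
    · refine (continuousAt_const (y := (0 : ℝ))).congr ?_
      filter_upwards [(hlf.isClosed_iUnion hCcl).isOpen_compl.mem_nhds hy] with z hz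
      by_contra hne
      obtain ⟨n, hn⟩ := hhC z fun h0 => hne (by rw [h0, mul_zero])
      exact hz (mem_iUnion.2 ⟨n, hn⟩)⟩
  obtain ⟨q, hq⟩ := exists_clusterPt_of_compactSpace (map (e ∘ x) atTop)
  have hq' : ∀ V ∈ 𝓝 q, ∃ᶠ n in atTop, e (x n) ∈ V := fun V hV =>
    (mapClusterPt_iff_frequently (u := e ∘ x)).1 hq V hV
  have hqe : q ∉ range e := by
    rintro ⟨y, rfl⟩
    obtain ⟨W, hW, hfin⟩ := hlf y
    rw [he.nhds_eq_comap] at hW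
    obtain ⟨V, hV, hVW⟩ := hW
    exact Nat.frequently_atTop_iff_infinite.1 (hq' V hV)
      (hfin.subset fun n hn => ⟨x n, hxC n, hVW hn⟩)
  have hqh : h' q = 1 := by
    by_contra hne
    obtain ⟨n, hn⟩ := (hq' _ (h'.continuous.continuousAt.eventually_ne hne)).exists
    exact hn ((hh' _).trans (hhx n))
  obtain ⟨ν, hνh, hνe, hνb⟩ := mem_closure_iff.1 (hN hqe) {b | 1 / 2 < h' b}
    (isOpen_lt continuous_const h'.continuous) (by rw [mem_ofPred_eq, hqh]; norm_num)
  obtain ⟨V, hV, M, hM⟩ := hνb k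
  refine hνe ?_
  -- If `y ∈ C n`, `h y > 1/2` and `|F y * h y| ≤ M`, then `n < F y ≤ 2 * M`.
  let L : Set Y := ⋃ n ∈ Iic ⌈2 * M⌉₊, C n
  have hL : IsCompact L := (finite_Iic _).isCompact_biUnion fun n _ => hCc n
  have hVL : interior (V ∩ {b | 1 / 2 < h' b}) ∩ range e ⊆ e '' L := by
    rintro _ ⟨hb, y, rfl⟩
    have hb' := interior_subset hb
    have hhy : 1 / 2 < h y := by rw [← hh']; exact hb'.2
    obtain ⟨n, hn⟩ := hhC y (by linarith)
    refine ⟨y, mem_iUnion₂.2 ⟨n, ?_, hn⟩, rfl⟩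
    have h1 : (n : ℝ) < F y := (hCU n hn).2
    have h2 : |F y * h y| ≤ M := hM y hb'.1
    have h3 := (le_abs_self _).trans h2
    have h4 : (0 : ℝ) ≤ n := n.cast_nonneg
    have h5 := Nat.le_ceil (2 * M)
    have : (n : ℝ) ≤ ⌈2 * M⌉₊ := by nlinarith
    exact_mod_cast this
  have hνint : ν ∈ interior (V ∩ {b | 1 / 2 < h' b}) := mem_interior_iff_mem_nhds.2
    (inter_mem hV ((isOpen_lt continuous_const h'.continuous).mem_nhds hνh))
  exact image_subset_range e L (closure_minimal hVL (hL.image he.continuous).isClosed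
    (hd.open_subset_closure_inter isOpen_interior hνint))

/-- Arbitrarily near each point lies a `z` with no compact neighbourhood, so `e z` is a limit of
real remainder points. Inside a realcompact neighbourhood this contradicts
`mem_range_of_isRealcompactSpace`. -/
theorem isAntiLocallyRealcompact_closure (he : IsEmbedding e) (hd : DenseRange e)
    (hN : (range e)ᶜ ⊆ closure (realRemainder e)) :
    IsAntiLocallyRealcompact (closure (closure (e ⁻¹' interior (range e)))ᶜ : Set Y) := by
  rintro ⟨y, hy⟩ ⟨P, hP, hPr⟩
  rw [nhds_subtype_eq_comap] at hP
  obtain ⟨V, hV, hVP⟩ := hP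
  obtain ⟨W, hWV, hW, hyW⟩ := mem_nhds_iff.1 hV
  obtain ⟨z, hzW, hz⟩ := mem_closure_iff.1 hy W hW hyW
  have hnhds := (hW.inter isClosed_closure.isOpen_compl).mem_nhds ⟨hzW, hz⟩
  rw [he.nhds_eq_comap] at hnhds
  obtain ⟨O, hO, hOW⟩ := hnhds
  have hzN : e z ∈ closure (realRemainder e) := by
    refine closure_minimal hN isClosed_closure ?_
    rw [closure_compl]
    exact fun h => hz (subset_closure h)
  obtain ⟨ν, hνO, hνe, hνb⟩ := mem_closure_iff.1 hzN _ isOpen_interior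
    (mem_interior_iff_mem_nhds.2 hO)
  refine hνe (mem_range_of_isRealcompactSpace he.continuous hd
    (IsEmbedding.subtypeVal.comp (IsEmbedding.subtypeVal (p := (· ∈ P)))) hPr hνb
    (mem_interior_iff_mem_nhds.1 hνO) fun w hw => ?_)
  have hw' := hOW hw
  exact ⟨⟨⟨w, subset_closure hw'.2⟩, hVP (hWV hw'.1)⟩, rfl⟩

/-- A dense subspace `Y` of a compact space is nearly pseudocompact if it is `C*`-embedded and the
points of the remainder near which continuous functions on `Y` are bounded are dense in the
remainder. -/
theorem isNearlyPseudocompact_of_dense_realRemainder (he : IsEmbedding e) (hd : DenseRange e)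
    (hN : (range e)ᶜ ⊆ closure (realRemainder e))
    (hext : ∀ h : C(Y, ℝ), (∀ y, h y ∈ Icc (0 : ℝ) 1) → ∃ h' : C(B, ℝ), ∀ y, h' (e y) = h y) :
    IsNearlyPseudocompact Y := by
  have hU : IsOpen (e ⁻¹' interior (range e)) := isOpen_interior.preimage he.continuous
  refine ⟨closure (e ⁻¹' interior (range e)), closure (closure (e ⁻¹' interior (range e)))ᶜ,
    ?_, ⟨?_, ?_, isPseudocompactSpace_closure he hd hN hext⟩,
    ⟨?_, isAntiLocallyRealcompact_closure he hd hN⟩, ?_⟩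
  · exact eq_univ_of_forall fun y => (em _).imp id fun h => subset_closure h
  · exact subset_antisymm (closure_minimal interior_subset isClosed_closure)
      (closure_mono (interior_maximal subset_closure hU))
  · rw [IsAlmostLocallyCompact]
    congr 1
    ext y
    exact (exists_isCompact_mem_nhds_iff he hd).symm
  · exact subset_antisymm (closure_minimal interior_subset isClosed_closure)
      (closure_mono (interior_maximal subset_closure isClosed_closure.isOpen_compl))
  · have := interior_frontier (isClosed_closure (s := e ⁻¹' interior (range e)))
    rwa [frontier_eq_closure_inter_closure, closure_closure] at this

end DenseEmbedding

/-! ### Zero sets and closures in `βX` -/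

section StoneCech

universe u

variable {X : Type u} [TopologicalSpace X]

theorem exists_stoneCech_extension (h : C(X, ℝ)) (hh : ∀ x, h x ∈ Icc (0 : ℝ) 1) :
    ∃ h' : C(StoneCech X, ℝ), ∀ x, h' (stoneCechUnit x) = h x := by
  have hc : Continuous fun x => (⟨h x, hh x⟩ : Icc (0 : ℝ) 1) := h.continuous.subtype_mk _
  refine ⟨⟨fun b => ((stoneCechExtend hc b : Icc (0 : ℝ) 1) : ℝ),
    continuous_subtype_val.comp (continuous_stoneCechExtend hc)⟩, fun x => ?_⟩
  change ((stoneCechExtend hc (stoneCechUnit x) : Icc (0 : ℝ) 1) : ℝ) = h x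
  rw [stoneCechExtend_stoneCechUnit]

theorem isZeroSet_preimage_le {B : Type*} [TopologicalSpace B] (φ : C(B, ℝ)) {j : X → B}
    (hj : Continuous j) (c : ℝ) : IsZeroSet (j ⁻¹' {b | φ b ≤ c}) :=
  ⟨⟨fun x => max 0 (φ (j x) - c), by fun_prop⟩, by ext x; simp⟩

theorem isZeroSet_preimage_ge {B : Type*} [TopologicalSpace B] (φ : C(B, ℝ)) {j : X → B}
    (hj : Continuous j) (c : ℝ) : IsZeroSet (j ⁻¹' {b | c ≤ φ b}) :=
  ⟨⟨fun x => max 0 (c - φ (j x)), by fun_prop⟩, by ext x; simp⟩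

/-- Disjoint zero sets have disjoint closures in `βX`. -/
theorem notMem_closure_of_disjoint {Z W : Set X} (hZ : IsZeroSet Z) (hW : IsZeroSet W)
    (hZW : Z ∩ W = ∅) {b : StoneCech X} (hbZ : b ∈ closure (stoneCechUnit '' Z)) :
    b ∉ closure (stoneCechUnit '' W) := by
  intro hbW
  obtain ⟨f, rfl⟩ := hZ
  obtain ⟨g, rfl⟩ := hW
  have hpos : ∀ x, 0 < |f x| + |g x| := by
    intro x
    by_contra! h
    have hf : f x = 0 := abs_eq_zero.1 (le_antisymm (by linarith [abs_nonneg (g x)]) (abs_nonneg _))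
    have hg : g x = 0 := abs_eq_zero.1 (le_antisymm (by linarith [abs_nonneg (f x)]) (abs_nonneg _))
    exact (hZW ▸ ⟨hf, hg⟩ : x ∈ (∅ : Set X))
  obtain ⟨h, hh⟩ := exists_stoneCech_extension
    ⟨fun x => |f x| / (|f x| + |g x|), by
      refine Continuous.div (by fun_prop) (by fun_prop) fun x => (hpos x).ne'⟩
    (fun x => ⟨div_nonneg (abs_nonneg _) (hpos x).le,
      (div_le_one (hpos x)).2 (by linarith [abs_nonneg (g x)])⟩)
  have h0 : h b = 0 := by
    refine closure_minimal (t := {b | h b = 0}) ?_ (isClosed_eq h.continuous continuous_const) hbZ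
    rintro _ ⟨x, hx, rfl⟩
    have hx' : f x = 0 := hx
    simp [hh, hx']
  have h1 : h b = 1 := by
    refine closure_minimal (t := {b | h b = 1}) ?_ (isClosed_eq h.continuous continuous_const) hbW
    rintro _ ⟨x, hx, rfl⟩
    have hx' : g x = 0 := hx
    have := hpos x
    rw [hx', abs_zero, add_zero] at this
    simp [hh, hx', this.ne']
  exact zero_ne_one (h0.symm.trans h1)

/-- Traces of neighbourhoods can be shrunk to zero sets that still contain such a trace. -/
theorem exists_isZeroSet_nhds {b : StoneCech X} {O : Set (StoneCech X)} (hO : O ∈ 𝓝 b) :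
    ∃ Z : Set X, IsZeroSet Z ∧ Z ⊆ stoneCechUnit ⁻¹' O ∧
      ∃ G ∈ 𝓝 b, stoneCechUnit ⁻¹' G ⊆ Z := by
  obtain ⟨φ, h0, h1, -⟩ := exists_continuous_lt_one_subset hO
  refine ⟨_, isZeroSet_preimage_le φ continuous_stoneCechUnit (1 / 2), fun x hx => h1 _ ?_,
    {b | φ b < 1 / 2}, ?_, fun x (hx : φ (stoneCechUnit x) < 1 / 2) => hx.le⟩
  · have : φ (stoneCechUnit x) ≤ 1 / 2 := hx
    linarith
  · exact φ.continuous.continuousAt.eventually_lt continuousAt_const (by rw [h0]; norm_num)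

theorem mem_closure_image_inter {A : Set X} {b : StoneCech X}
    (hA : b ∈ closure (stoneCechUnit '' A)) {Z : Set X} {G : Set (StoneCech X)} (hG : G ∈ 𝓝 b)
    (hGZ : stoneCechUnit ⁻¹' G ⊆ Z) : b ∈ closure (stoneCechUnit '' (A ∩ Z)) := by
  rw [mem_closure_iff_nhds] at hA ⊢
  intro t ht
  obtain ⟨_, ⟨h1, h2⟩, x, hx, rfl⟩ := hA _ (inter_mem ht hG)
  exact ⟨_, h1, x, ⟨hx, hGZ h2⟩, rfl⟩

theorem mem_closure_image_of_nhds {b : StoneCech X} {Z : Set X} {G : Set (StoneCech X)}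
    (hG : G ∈ 𝓝 b) (hGZ : stoneCechUnit ⁻¹' G ⊆ Z) : b ∈ closure (stoneCechUnit '' Z) := by
  have := mem_closure_image_inter (A := univ) (b := b)
    (by rw [image_univ]; exact denseRange_stoneCechUnit b) hG hGZ
  rwa [univ_inter] at this

/-! ### Z-ultrafilters as points of `βX` -/

/-- The zero sets of `X` whose closure in `βX` contains `b`. -/
def zeroSetTrace (b : StoneCech X) : Set (Set X) :=
  {Z | IsZeroSet Z ∧ b ∈ closure (stoneCechUnit '' Z)}

theorem isZUltrafilter_zeroSetTrace (b : StoneCech X) : IsZUltrafilter (zeroSetTrace b) := by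
  have hz : IsZFilter (zeroSetTrace b) :=
    { isZeroSet := fun Z hZ => hZ.1
      nonempty := by
        obtain ⟨Z, hZ, -, G, hG, hGZ⟩ := exists_isZeroSet_nhds (b := b) univ_mem
        exact ⟨Z, hZ, mem_closure_image_of_nhds hG hGZ⟩
      empty_notMem := fun h => by simpa using h.2
      inter_mem := by
        rintro Z ⟨hZ, hbZ⟩ W ⟨hW, hbW⟩
        refine ⟨isZeroSet_inter hZ hW, ?_⟩
        by_contra hb
        obtain ⟨A, hA, hAc, G, hG, hGA⟩ :=
          exists_isZeroSet_nhds (isClosed_closure.isOpen_compl.mem_nhds hb)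
        refine notMem_closure_of_disjoint (isZeroSet_inter hZ hA) (isZeroSet_inter hW hA) ?_
          (mem_closure_image_inter hbZ hG hGA) (mem_closure_image_inter hbW hG hGA)
        rw [eq_empty_iff_forall_notMem]
        rintro x ⟨⟨hxZ, hxA⟩, hxW, -⟩
        exact hAc hxA (subset_closure ⟨x, ⟨hxZ, hxW⟩, rfl⟩)
      superset_mem := fun Z hZ W hW hZW => ⟨hW, closure_mono (image_mono hZW) hZ.2⟩ }
  refine ⟨hz, fun q hq hpq Z hZ => ⟨hq.isZeroSet Z hZ, ?_⟩⟩
  by_contra hb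
  obtain ⟨A, hA, hAc, G, hG, hGA⟩ :=
    exists_isZeroSet_nhds (isClosed_closure.isOpen_compl.mem_nhds hb)
  have hAq : A ∈ q := hpq ⟨hA, mem_closure_image_of_nhds hG hGA⟩
  refine hq.empty_notMem ?_
  convert hq.inter_mem A hAq Z hZ
  rw [eq_comm, eq_empty_iff_forall_notMem]
  rintro x ⟨hxA, hxZ⟩
  exact hAc hxA (subset_closure ⟨x, hxZ, rfl⟩)

/-- Compactness gives a point common to the closures of all members; maximality turns the inclusion
into equality. -/
theorem IsZUltrafilter.exists_eq_zeroSetTrace {p : Set (Set X)} (hp : IsZUltrafilter p) :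
    ∃ b, p = zeroSetTrace b := by
  have : Nonempty p := hp.1.nonempty.to_subtype
  obtain ⟨b, hb⟩ := IsCompact.nonempty_iInter_of_directed_nonempty_isCompact_isClosed
    (fun Z : p => closure ((stoneCechUnit : X → StoneCech X) '' Z))
    (fun Z W => ⟨⟨Z ∩ W, hp.1.inter_mem Z Z.2 W W.2⟩,
      closure_mono (image_mono inter_subset_left), closure_mono (image_mono inter_subset_right)⟩)
    (fun Z => ((nonempty_iff_ne_empty.2 fun h => hp.1.empty_notMem (h ▸ Z.2)).image _).closure)
    (fun Z => isClosed_closure.isCompact) (fun Z => isClosed_closure)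
  rw [mem_iInter] at hb
  exact ⟨b, hp.eq_of_subset (isZUltrafilter_zeroSetTrace b).1
    fun Z hZ => ⟨hp.1.isZeroSet Z hZ, hb ⟨Z, hZ⟩⟩⟩

theorem eq_of_forall_mem_closure {b c : StoneCech X}
    (h : ∀ Z ∈ zeroSetTrace b, c ∈ closure (stoneCechUnit '' Z)) : b = c := by
  by_contra hne
  obtain ⟨U, V, hU, hV, hbU, hcV, hUV⟩ := t2_separation hne
  obtain ⟨Z, hZ, hZU, G, hG, hGZ⟩ := exists_isZeroSet_nhds (hU.mem_nhds hbU)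
  have h1 : c ∈ closure U := closure_mono (image_subset_iff.2 hZU)
    (h Z ⟨hZ, mem_closure_image_of_nhds hG hGZ⟩)
  exact (hUV.closure_left hV).le_bot ⟨h1, hcV⟩

theorem zeroSetTrace_injective : Function.Injective (zeroSetTrace (X := X)) := fun b c h =>
  eq_of_forall_mem_closure fun Z hZ => by
    rw [h] at hZ
    exact hZ.2

/-! ### The space `δX` inside `βX` and the real remainder of `X` -/

/-- The point of `βX` to which a point of `δX` converges. -/
noncomputable def Delta.toStoneCech (p : Delta X) : StoneCech X :=
  p.isZUltrafilter.exists_eq_zeroSetTrace.choose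

theorem Delta.val_eq_zeroSetTrace (p : Delta X) : p.1 = zeroSetTrace p.toStoneCech :=
  p.isZUltrafilter.exists_eq_zeroSetTrace.choose_spec

theorem Delta.mem_range_toStoneCech {b : StoneCech X}
    (hb : (⋂₀ zeroSetTrace b).Nonempty ∨ IsHZUltrafilter (zeroSetTrace b)) :
    b ∈ range (Delta.toStoneCech (X := X)) := by
  refine ⟨⟨zeroSetTrace b, hb.imp_left fun h => ⟨isZUltrafilter_zeroSetTrace b, h⟩⟩, ?_⟩
  exact zeroSetTrace_injective (Delta.val_eq_zeroSetTrace _).symm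

theorem Delta.isEmbedding_toStoneCech : IsEmbedding (Delta.toStoneCech (X := X)) := by
  refine ⟨⟨le_antisymm ?_ ?_⟩, fun p q h => Subtype.ext ?_⟩
  · rw [← continuous_iff_le_induced, continuous_iff_continuousAt]
    intro p O hO
    obtain ⟨φ, h0, h1, -⟩ := exists_continuous_lt_one_subset hO
    have hW := isZeroSet_preimage_ge φ (continuous_stoneCechUnit (α := X)) (1 / 2)
    have hp : p ∈ (Delta.bar (stoneCechUnit ⁻¹' {b : StoneCech X | 1 / 2 ≤ φ b}))ᶜ := by
      intro hp
      change _ ∈ p.1 at hp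
      rw [p.val_eq_zeroSetTrace] at hp
      have h2 : (1 : ℝ) / 2 ≤ φ p.toStoneCech :=
        closure_minimal (image_preimage_subset _ _)
          (isClosed_le continuous_const φ.continuous) hp.2
      rw [h0] at h2
      norm_num at h2
    rw [mem_map]
    filter_upwards [(Delta.isTopologicalBasis_compl_bar.isOpen ⟨_, hW, rfl⟩).mem_nhds hp] with q hq
    refine h1 _ ?_
    by_contra! hge
    refine hq ?_
    change _ ∈ q.1
    rw [q.val_eq_zeroSetTrace]
    refine ⟨hW, mem_closure_image_of_nhds (G := {b | 1 / 2 < φ b}) ?_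
      fun x (hx : 1 / 2 < φ (stoneCechUnit x)) => hx.le⟩
    exact (isOpen_lt continuous_const φ.continuous).mem_nhds
      (show (1 : ℝ) / 2 < φ q.toStoneCech by linarith)
  · refine le_generateFrom ?_
    rintro _ ⟨Z, hZ, rfl⟩
    refine isOpen_induced_iff.2 ⟨(closure (stoneCechUnit '' Z))ᶜ, isClosed_closure.isOpen_compl, ?_⟩
    ext p
    change _ ↔ Z ∉ p.1
    rw [p.val_eq_zeroSetTrace]
    exact not_congr ⟨fun h => ⟨hZ, h⟩, And.right⟩
  · rw [p.val_eq_zeroSetTrace, q.val_eq_zeroSetTrace, h]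

/-- A free `z`-ultrafilter with a hard member does not converge to a point of the real remainder. -/
theorem mem_range_of_isHard_mem_zeroSetTrace {b : StoneCech X}
    (hb : BoundedAt (stoneCechUnit : X → StoneCech X) b) {H : Set X} (hH : IsHard H)
    (hHb : H ∈ zeroSetTrace b) : b ∈ range (stoneCechUnit : X → StoneCech X) := by
  by_contra hbr
  obtain ⟨-, K, hK, hV⟩ := hH
  obtain ⟨φ, h0, h1, -⟩ := exists_continuous_zero_at_one_on
    (hK.image continuous_stoneCechUnit).isClosed fun h => hbr (image_subset_range _ _ h)
  -- This open set contains `K` but stays away from `b`, so near `b` the set `H` lies in `H \ V`,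
  -- where `f` vanishes.
  obtain ⟨P, hP, f, hf, hf0, hf1⟩ := hV (stoneCechUnit ⁻¹' {b | 1 / 2 < φ b})
    ((isOpen_lt continuous_const φ.continuous).preimage continuous_stoneCechUnit) fun x hx =>
      show 1 / 2 < φ (stoneCechUnit x) by rw [h1 _ ⟨x, hx, rfl⟩]; norm_num
  obtain ⟨f', hf'⟩ := exists_stoneCech_extension f hf
  have hfb : f' b = 0 := by
    by_contra hne
    obtain ⟨_, ⟨h2, h3⟩, x, hx, rfl⟩ := mem_closure_iff_nhds.1 hHb.2 _ (inter_mem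
      (f'.continuous.continuousAt.eventually_ne hne)
      (φ.continuous.continuousAt.eventually_lt continuousAt_const
        (show φ b < 1 / 2 by rw [h0]; norm_num)))
    have h3' : φ (stoneCechUnit x) < 1 / 2 := h3
    refine h2 ?_
    rw [hf']
    exact hf0 x ⟨hx, not_lt.2 h3'.le⟩
  refine hbr (mem_range_of_isRealcompactSpace continuous_stoneCechUnit denseRange_stoneCechUnit
    (IsEmbedding.subtypeVal (p := (· ∈ P))) hP hb (O := {b | f' b < 1})
    (f'.continuous.continuousAt.eventually_lt continuousAt_const (by rw [hfb]; norm_num))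
    fun x hx => ?_)
  rw [Subtype.range_coe]
  by_contra hxP
  have h2 : f' (stoneCechUnit x) < 1 := hx
  rw [hf', hf1 x hxP] at h2
  exact lt_irrefl _ h2

theorem notMem_range_toStoneCech {b : StoneCech X}
    (hb : b ∈ realRemainder (stoneCechUnit : X → StoneCech X)) :
    b ∉ range (Delta.toStoneCech (X := X)) := by
  rintro ⟨p, rfl⟩
  have hv := p.val_eq_zeroSetTrace
  rcases p.2 with ⟨-, x, hx⟩ | hz
  · refine hb.1 ⟨x, (eq_of_forall_mem_closure fun Z hZ => subset_closure ⟨x, ?_, rfl⟩).symm⟩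
    exact hx Z (hv ▸ hZ)
  · obtain ⟨W, hW⟩ := hz.1.1.nonempty
    obtain ⟨H, hH, -, hhard, -⟩ := hz.1.2 W hW
    exact hb.1 (mem_range_of_isHard_mem_zeroSetTrace hb.2 hhard (hv ▸ hH))

variable [T35Space X]

theorem mem_of_stoneCechUnit_mem_closure {Z : Set X} (hZ : IsClosed Z) {x : X}
    (hx : stoneCechUnit x ∈ closure (stoneCechUnit '' Z)) : x ∈ Z := by
  rw [← hZ.closure_eq, isEmbedding_stoneCechUnit.isInducing.closure_eq_preimage_closure_image]
  exact hx

theorem stoneCechUnit_mem_range_toStoneCech (x : X) :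
    stoneCechUnit x ∈ range (Delta.toStoneCech (X := X)) :=
  Delta.mem_range_toStoneCech <| Or.inl
    ⟨x, fun _ hZ => mem_of_stoneCechUnit_mem_closure hZ.1.isClosed hZ.2⟩

/-- A closed trace on `X` of a region of `βX` missing the real remainder is realcompact. -/
theorem isRealcompactSpace_preimage {C : Set (StoneCech X)} (hC : IsClosed C)
    (hCN : Disjoint C (realRemainder (stoneCechUnit : X → StoneCech X))) :
    IsRealcompactSpace (stoneCechUnit ⁻¹' C : Set X) := by
  intro S hS hstable hfip
  have hne : (generate S).NeBot := generate_neBot_iff.2 hfip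
  let j : (stoneCechUnit ⁻¹' C : Set X) → StoneCech X := fun q => stoneCechUnit q
  have hj : IsEmbedding j := isEmbedding_stoneCechUnit.comp IsEmbedding.subtypeVal
  obtain ⟨b, hb⟩ := exists_clusterPt_of_compactSpace (map j (generate S))
  have hbD : ∀ D ∈ generate S, b ∈ closure (j '' D) := fun D hD =>
    hb.mem_closure_of_mem _ (image_mem_map hD)
  have hbC : b ∈ C := closure_minimal (by rintro _ ⟨q, -, rfl⟩; exact q.2) hC
    (hbD univ univ_mem)
  have hbr : b ∈ range (stoneCechUnit : X → StoneCech X) := by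
    by_contra hbr
    refine hCN.le_bot ⟨hbC, hbr, ?_⟩
    by_contra hbb
    simp only [BoundedAt, not_forall, not_exists, not_and, not_le] at hbb
    obtain ⟨f, hf⟩ := hbb
    have hpos : ∀ x, 0 < 1 + |f x| := fun x => by positivity
    -- The extension of `1 / (1 + |f|)` should vanish at `b` because `f` is unbounded near `b`. But
    -- stability keeps it at least `c` on a set of `S` whose closure contains `b`.
    obtain ⟨h, hh⟩ := exists_stoneCech_extension
      ⟨fun x => 1 / (1 + |f x|), continuous_const.div (by fun_prop) fun x => (hpos x).ne'⟩
      (fun x => ⟨(one_div_pos.2 (hpos x)).le,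
        (div_le_one (hpos x)).2 (by linarith [abs_nonneg (f x)])⟩)
    obtain ⟨D, hD, M, hM⟩ := hstable (f.comp ⟨Subtype.val, continuous_subtype_val⟩)
    set c := 1 / (1 + |M|) with hc
    have hcpos : 0 < c := by positivity
    have hcb : c ≤ h b := by
      refine closure_minimal (t := {b | c ≤ h b}) ?_ (isClosed_le continuous_const h.continuous)
        (hbD D (mem_generate_of_mem hD))
      rintro _ ⟨q, hq, rfl⟩
      change c ≤ h (stoneCechUnit (q : X))
      rw [hh]
      have h1 : |f q| ≤ M := hM q hq
      exact one_div_le_one_div_of_le (hpos q) (by linarith [le_abs_self M])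
    obtain ⟨x, hx, hxM⟩ := hf {b | c / 2 < h b}
      ((isOpen_lt continuous_const h.continuous).mem_nhds (show c / 2 < h b by linarith)) (2 / c)
    have h1 : c / 2 < h (stoneCechUnit x) := hx
    rw [hh, ContinuousMap.coe_mk] at h1
    rw [lt_div_iff₀ (hpos x)] at h1
    rw [div_lt_iff₀ hcpos] at hxM
    nlinarith
  obtain ⟨x, rfl⟩ := hbr
  refine ⟨⟨x, hbC⟩, fun D hD => ?_⟩
  rw [← (hS D hD).closure_eq, hj.isInducing.closure_eq_preimage_closure_image]
  exact hbD D (mem_generate_of_mem hD)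

/-- A function separating `b` from the closure of the remainder gives sublevel sets with realcompact
trace. The inner one is hard with empty `K`, and intersecting with it makes every member hard. -/
theorem isHZUltrafilter_zeroSetTrace {b : StoneCech X}
    (hb : b ∉ closure (realRemainder (stoneCechUnit : X → StoneCech X))) :
    IsHZUltrafilter (zeroSetTrace b) := by
  obtain ⟨φ, h0, h1, -⟩ := exists_continuous_zero_at_one_on isClosed_closure hb
  let H : Set X := stoneCechUnit ⁻¹' {b | φ b ≤ 1 / 3}
  have hH : IsZeroSet H := isZeroSet_preimage_le φ continuous_stoneCechUnit _
  have hhard : IsHard H := by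
    refine ⟨hH.isClosed, ∅, isCompact_empty, fun V _ _ =>
      ⟨stoneCechUnit ⁻¹' {b | φ b ≤ 2 / 3}, isRealcompactSpace_preimage
        (isClosed_le φ.continuous continuous_const) (disjoint_left.2 fun c hc hcN => ?_),
        ⟨fun x => min 1 (max 0 (3 * φ (stoneCechUnit x) - 1)), ?_⟩, ?_, ?_, ?_⟩⟩
    · have h2 : φ c ≤ 2 / 3 := hc
      rw [h1 c (subset_closure hcN)] at h2
      norm_num at h2
    · have := continuous_stoneCechUnit (α := X)
      fun_prop
    · exact fun x => ⟨le_min zero_le_one (le_max_left _ _), min_le_left _ _⟩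
    · rintro x ⟨hx, -⟩
      have h2 : φ (stoneCechUnit x) ≤ 1 / 3 := hx
      change min 1 (max 0 (3 * φ (stoneCechUnit x) - 1)) = 0
      rw [max_eq_left (by linarith), min_eq_right zero_le_one]
    · intro x hx
      have h2 : ¬ φ (stoneCechUnit x) ≤ 2 / 3 := hx
      change min 1 (max 0 (3 * φ (stoneCechUnit x) - 1)) = 1
      exact min_eq_left (le_max_of_le_right (by linarith))
  have hHb : H ∈ zeroSetTrace b := ⟨hH, mem_closure_image_of_nhds (G := {b | φ b < 1 / 3})
    (φ.continuous.continuousAt.eventually_lt continuousAt_const (by rw [h0]; norm_num))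
    fun x (hx : φ (stoneCechUnit x) < 1 / 3) => hx.le⟩
  have hu := isZUltrafilter_zeroSetTrace b
  refine ⟨⟨hu.1, fun Z hZ => ?_⟩, fun q hq hpq => hu.2 hq.1 hpq⟩
  have hm := hu.1.inter_mem Z hZ H hHb
  exact ⟨Z ∩ H, hm, hm.1, isHard_of_subset hhard hm.1.isClosed inter_subset_right,
    inter_subset_left⟩

/-- The canonical map of `X` into `δX`. -/
noncomputable def Delta.unit (x : X) : Delta X :=
  (stoneCechUnit_mem_range_toStoneCech x).choose

theorem Delta.toStoneCech_unit (x : X) : (Delta.unit x).toStoneCech = stoneCechUnit x :=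
  (stoneCechUnit_mem_range_toStoneCech x).choose_spec

theorem Delta.continuous_unit : Continuous (Delta.unit (X := X)) := by
  rw [Delta.isEmbedding_toStoneCech.continuous_iff]
  exact continuous_stoneCechUnit.congr fun x => (Delta.toStoneCech_unit x).symm

theorem Delta.denseRange_unit : DenseRange (Delta.unit (X := X)) := by
  intro p
  rw [Delta.isEmbedding_toStoneCech.isInducing.closure_eq_preimage_closure_image, ← range_comp,
    show Delta.toStoneCech ∘ Delta.unit = (stoneCechUnit : X → StoneCech X) from
      funext Delta.toStoneCech_unit]
  exact denseRange_stoneCechUnit _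

theorem Delta.denseRange_toStoneCech : DenseRange (Delta.toStoneCech (X := X)) :=
  denseRange_stoneCechUnit.mono (range_subset_iff.2 stoneCechUnit_mem_range_toStoneCech)

/-- A bound near `b` for the restriction to `X` passes to `δX` by density of `X`. -/
theorem realRemainder_stoneCechUnit_subset :
    realRemainder (stoneCechUnit : X → StoneCech X) ⊆
      realRemainder (Delta.toStoneCech (X := X)) := by
  refine fun b hb => ⟨notMem_range_toStoneCech hb, fun f => ?_⟩
  obtain ⟨U, hU, M, hM⟩ := hb.2 (f.comp ⟨Delta.unit, Delta.continuous_unit⟩)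
  refine ⟨interior U, interior_mem_nhds.2 hU, M, fun p hp => ?_⟩
  by_contra! hlt
  obtain ⟨x, hxU, hx⟩ := Delta.denseRange_unit.exists_mem_open
    ((isOpen_interior.preimage Delta.isEmbedding_toStoneCech.continuous).inter
      (isOpen_lt continuous_const f.continuous.abs)) ⟨p, hp, hlt⟩
  rw [mem_preimage, Delta.toStoneCech_unit] at hxU
  exact not_le.2 hx (hM x (interior_subset hxU))

end StoneCech

end NearlyPseudo

open NearlyPseudo in
theorem mainTheorem1 {X : Type*} [TopologicalSpace X] [T35Space X] :
    T35Space (NearlyPseudo.Delta X) ∧ NearlyPseudo.IsNearlyPseudocompact (NearlyPseudo.Delta X) := by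
  refine ⟨Delta.isEmbedding_toStoneCech.t35Space, isNearlyPseudocompact_of_dense_realRemainder
    Delta.isEmbedding_toStoneCech Delta.denseRange_toStoneCech (fun b hb => ?_) fun h hh => ?_⟩
  · by_contra hbN
    exact hb (Delta.mem_range_toStoneCech (Or.inr (isHZUltrafilter_zeroSetTrace fun hbX =>
      hbN (closure_mono realRemainder_stoneCechUnit_subset hbX))))
  -- Extend the restriction to `X`; both functions agree on the dense image of `X`, hence on `δX`.
  · obtain ⟨h', hh'⟩ := exists_stoneCech_extension
      (h.comp ⟨Delta.unit, Delta.continuous_unit⟩) fun x => hh _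
    refine ⟨h', congrFun (Delta.denseRange_unit.equalizer
      (h'.continuous.comp Delta.isEmbedding_toStoneCech.continuous) h.continuous ?_)⟩
    ext x
    simp only [Function.comp_apply, Delta.toStoneCech_unit, hh']
    rfl
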